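/- For an integer $N\ge 3$ let $T^2_N$ be the two-dimensional discrete torus, i.e. the Cayley graph of the group $\mathbb{Z}/N\mathbb{Z}\times\mathbb{Z}/N\mathbb{Z}$ with generating set $\{(0,1),(0,-1),(1,0),(-1,0)\}$. For $k_1,k_2\in\mathbb{Z}/N\mathbb{Z}$ put $$\mu_N(k_1,k_2)=2\cos\frac{2k_1\pi}{N}+2\cos\frac{2k_2\pi}{N}.$$ Then for every $N\ge 3$, every nonzero eigenvalue of the adjacency matrix of $T^2_N$ has multiplicity at most $24$. The bound is attained: $\mu_{60}(24,10)$ is nonzero and is an eigenvalue of the adjacency matrix of $T^2_{60}$ of multiplicity exactly $24$. -/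

import Mathlib

/-- The discrete torus `T²_N`: the Cayley graph of `ℤ/N × ℤ/N` with generating set
`{(0, 1), (0, -1), (1, 0), (-1, 0)}`. -/
def discreteTorus (N : ℕ) : SimpleGraph (ZMod N × ZMod N) :=
  SimpleGraph.addCayley {(0, 1), (0, -1), (1, 0), (-1, 0)}

open Classical in
/-- The adjacency matrix of `T²_N`, with real entries. -/
noncomputable def torusAdjMatrix (N : ℕ) : Matrix (ZMod N × ZMod N) (ZMod N × ZMod N) ℝ :=
  (discreteTorus N).adjMatrix ℝ

/-- The multiplicity of `μ` in the spectrum of the adjacency matrix of `T²_N`, i.e. its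
multiplicity as a root of the characteristic polynomial. -/
noncomputable def torusMultiplicity (N : ℕ) [NeZero N] (μ : ℝ) : ℕ :=
  (torusAdjMatrix N).charpoly.rootMultiplicity μ

/-- The number `μ_N(k₁, k₂) = 2 cos (2 k₁ π / N) + 2 cos (2 k₂ π / N)`. -/
noncomputable def torusEigenvalue (N : ℕ) (k₁ k₂ : ZMod N) : ℝ :=
  2 * Real.cos (2 * (k₁.val : ℝ) * Real.pi / (N : ℝ)) +
    2 * Real.cos (2 * (k₂.val : ℝ) * Real.pi / (N : ℝ))

/-! The characters of the group diagonalise the adjacency matrix, so the multiplicity of `μ` is the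
number of pairs (k₁, k₂) with `torusEigenvalue N k₁ k₂ = μ`. A cosine fixes its partner and comes
from at most two residues, so it accounts for at most 2·2·2 = 8 pairs. The bound follows once three
cosines meet every representation of `μ` (`HasSmallCover`).

Covers are found by induction on N = qM. The conjugations ζ ↦ ζ^(1 + tM), combined by Fourier
inversion in t, extract from a pair sum the part with exponents in a class i modulo q. If i ≠ -i
this part has at most two terms, and a nonzero sum of two roots of unity determines them. This
handles squares of odd primes and the factor 8 (`hasSmallCover_of_coprime`). If a prime p ≥ 7
divides N exactly once, one t is lost and the parts are known only up to a term D^i C. When C ≠ 0,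
every class modulo p must occur among the exponents of two representations, which leaves just one
further cosine (`hasSmallCover_of_seven_le`). If only multiples of p occur, the representations live
at level N / p.

There remain the divisors of 60, where reducing the relations modulo 601 leaves a finite check
(`hasSmallCover_sixty`). -/

/-! ### Transfer of relations between roots of unity -/

/-- The sum `z ^ a + z ^ (-a) + z ^ b + z ^ (-b)`. -/
def pairSum {K : Type*} [Field K] (z : K) (a b : ℤ) : K :=
  z ^ a + z ^ (-a) + z ^ b + z ^ (-b)

theorem zpow_eq_pow_emod_toNat {K : Type*} [Field K] {z : K} {N : ℕ} (hN : 0 < N)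
    (hz : z ^ N = 1) (a : ℤ) : z ^ a = z ^ (a % N).toNat := by
  have hz0 : z ≠ 0 := by
    rintro rfl
    rw [zero_pow hN.ne'] at hz
    exact zero_ne_one hz
  have h0 : 0 ≤ a % N := Int.emod_nonneg _ (by exact_mod_cast hN.ne')
  conv_lhs => rw [← Int.emod_add_mul_ediv a N]
  rw [zpow_add₀ hz0, zpow_mul, zpow_natCast, hz, one_zpow, mul_one, ← zpow_natCast,
    Int.toNat_of_nonneg h0]

open Polynomial in
/-- An equality of pair sums at a complex primitive `N`-th root of unity holds at every root of
the `N`-th cyclotomic polynomial in a field. -/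
theorem pairSum_eq_of_isRoot_cyclotomic {N : ℕ} (hN : 0 < N) {ζ : ℂ} (hζ : IsPrimitiveRoot ζ N)
    {K : Type*} [Field K] {g : K} (hg : (cyclotomic N K).IsRoot g) {a b c d : ℤ}
    (h : pairSum ζ a b = pairSum ζ c d) : pairSum g a b = pairSum g c d := by
  have hgN : g ^ N = 1 := by
    obtain ⟨r, hr⟩ := cyclotomic.dvd_X_pow_sub_one N K
    have := congrArg (eval g) hr
    rw [eval_mul, IsRoot.def.mp hg, zero_mul] at this
    simpa [sub_eq_zero] using this
  -- Reducing exponents modulo N turns the relation into the vanishing of an integer polynomial at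
  -- ζ.
  let n : ℤ → ℕ := fun k => (k % N).toNat
  let P : ℤ[X] := X ^ n a + X ^ n (-a) + X ^ n b + X ^ n (-b)
    - (X ^ n c + X ^ n (-c) + X ^ n d + X ^ n (-d))
  have hP : aeval ζ P = 0 := by
    rw [← sub_eq_zero] at h
    simp only [P, n, map_sub, map_add, map_pow, aeval_X]
    simpa only [pairSum, ← zpow_eq_pow_emod_toNat hN hζ.pow_eq_one] using h
  have hdvd : cyclotomic N ℤ ∣ P := by
    rw [cyclotomic_eq_minpoly hζ hN]
    exact minpoly.isIntegrallyClosed_dvd (hζ.isIntegral hN) hP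
  obtain ⟨Q, hQ⟩ := hdvd
  have hPg : aeval g P = 0 := by
    rw [hQ, map_mul, aeval_def, eval₂_eq_eval_map, map_cyclotomic, IsRoot.def.mp hg, zero_mul]
  simp only [P, n, map_sub, map_add, map_pow, aeval_X] at hPg
  simp only [← zpow_eq_pow_emod_toNat hN hgN] at hPg
  exact sub_eq_zero.mp hPg

theorem pairSum_pow_eq {N : ℕ} (hN : 0 < N) {ζ : ℂ} (hζ : IsPrimitiveRoot ζ N) {s : ℕ}
    (hs : s.Coprime N) {a b c d : ℤ} (h : pairSum ζ a b = pairSum ζ c d) :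
    pairSum (ζ ^ s) a b = pairSum (ζ ^ s) c d :=
  pairSum_eq_of_isRoot_cyclotomic hN hζ ((hζ.pow_of_coprime s hs).isRoot_cyclotomic hN) h

/-! ### Components modulo q -/

/-- The part of `pairSum ζ a b` made of the powers of `ζ` whose exponent is `i` modulo `q`. -/
noncomputable def pairComponent (q : ℕ) (ζ : ℂ) (i a b : ℤ) : ℂ :=
  (if (a : ZMod q) = i then ζ ^ a else 0) + (if -(a : ZMod q) = i then ζ ^ (-a) else 0) +
    (if (b : ZMod q) = i then ζ ^ b else 0) + (if -(b : ZMod q) = i then ζ ^ (-b) else 0)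

theorem sum_range_zpow_mul_zpow {q : ℕ} (hq : 0 < q) {ω : ℂ} (hω : IsPrimitiveRoot ω q)
    (i k : ℤ) : ∑ t ∈ Finset.range q, ω ^ (-(i * t)) * ω ^ (k * t) =
      if (k : ZMod q) = i then (q : ℂ) else 0 := by
  have hω0 : ω ≠ 0 := hω.ne_zero hq.ne'
  have h1 : ∀ t : ℕ, ω ^ (-(i * t)) * ω ^ (k * t) = (ω ^ (k - i)) ^ t := by
    intro t
    rw [← zpow_add₀ hω0, ← zpow_natCast, ← zpow_mul]
    congr 1
    ring
  simp only [h1]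
  have h2 : (k : ZMod q) = i ↔ ω ^ (k - i) = 1 := by
    rw [hω.zpow_eq_one_iff_dvd, eq_comm, ZMod.intCast_eq_intCast_iff_dvd_sub]
  split_ifs with h
  · simp [h2.mp h]
  · have hne : ω ^ (k - i) ≠ 1 := fun h' => h (h2.mpr h')
    rw [geom_sum_eq hne, ← zpow_natCast, ← zpow_mul, mul_comm, zpow_mul, zpow_natCast,
      hω.pow_eq_one, one_zpow, sub_self, zero_div]

/-- Replacing ζ by ζ^(1 + tM) multiplies ζ^k by ω^(kt), where ω = ζ^M has order q, so a Fourier sum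
over t isolates the exponents k ≡ i. -/
theorem sum_range_mul_pairSum {q M : ℕ} (hq : 0 < q) (hM : 0 < M) {ζ : ℂ}
    (hζ : IsPrimitiveRoot ζ (q * M)) (i a b : ℤ) :
    ∑ t ∈ Finset.range q, (ζ ^ M) ^ (-(i * t)) * pairSum (ζ ^ (1 + t * M)) a b =
      q * pairComponent q ζ i a b := by
  have hω : IsPrimitiveRoot (ζ ^ M) q := hζ.pow (by positivity) (mul_comm _ _)
  have hζ0 : ζ ≠ 0 := hζ.ne_zero (by positivity)
  have h1 : ∀ (t : ℕ) (k : ℤ), (ζ ^ (1 + t * M)) ^ k = ζ ^ k * (ζ ^ M) ^ (k * t) := by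
    intro t k
    rw [← zpow_natCast, ← zpow_natCast, ← zpow_mul, ← zpow_mul, ← zpow_add₀ hζ0]
    congr 1
    push_cast
    ring
  have h2 : ∀ k : ℤ, ∑ t ∈ Finset.range q,
      (ζ ^ M) ^ (-(i * t)) * (ζ ^ (1 + t * M)) ^ k =
        q * if (k : ZMod q) = i then ζ ^ k else 0 := by
    intro k
    have := sum_range_zpow_mul_zpow hq hω i k
    simp only [h1, mul_left_comm _ (ζ ^ k), ← Finset.mul_sum, this]
    split_ifs <;> ring
  simp only [pairSum, mul_add, Finset.sum_add_distrib, h2, pairComponent]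
  push_cast
  ring

/-- If all the numbers `1 + t * M` are coprime to `q * M`, equal pair sums have equal components
modulo `q`. -/
theorem pairComponent_eq_of_coprime {q M : ℕ} (hq : 0 < q) (hM : 0 < M) {ζ : ℂ}
    (hζ : IsPrimitiveRoot ζ (q * M)) (hcop : ∀ t, (1 + t * M).Coprime (q * M)) {a b c d : ℤ}
    (h : pairSum ζ a b = pairSum ζ c d) (i : ℤ) :
    pairComponent q ζ i a b = pairComponent q ζ i c d := by
  have hq' : (q : ℂ) ≠ 0 := by exact_mod_cast hq.ne'
  refine mul_left_cancel₀ hq' ?_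
  rw [← sum_range_mul_pairSum hq hM hζ, ← sum_range_mul_pairSum hq hM hζ]
  refine Finset.sum_congr rfl fun t _ => ?_
  rw [pairSum_pow_eq (by positivity) hζ (hcop t) h]

/-- If a prime `p` divides `N` exactly once, the components modulo `p` of equal pair sums at a
primitive `N`-th root of unity differ by a constant, up to a fixed character. -/
theorem exists_pairComponent_sub_eq {p M : ℕ} (hp : p.Prime) (hM : 0 < M) (hpM : ¬ p ∣ M) {ζ : ℂ}
    (hζ : IsPrimitiveRoot ζ (p * M)) :
    ∃ D : ℂ, D ≠ 0 ∧ ∀ a b c d : ℤ, pairSum ζ a b = pairSum ζ c d →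
      ∃ C : ℂ, ∀ i : ℤ, pairComponent p ζ i a b - pairComponent p ζ i c d = D ^ i * C := by
  have := Fact.mk hp
  have hMp : (M : ZMod p) ≠ 0 := by rwa [Ne, ZMod.natCast_eq_zero_iff]
  -- The only class of t with p ∣ 1 + tM; for every other t, conjugation cancels the two pair sums.
  let t₀ : ZMod p := -(M : ZMod p)⁻¹
  have hζ0 : ζ ≠ 0 := hζ.ne_zero (Nat.mul_pos hp.pos hM).ne'
  refine ⟨(ζ ^ M) ^ (-(t₀.val : ℤ)), zpow_ne_zero _ (pow_ne_zero _ hζ0), fun a b c d h => ?_⟩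
  have hp' : (p : ℂ) ≠ 0 := by exact_mod_cast hp.pos.ne'
  refine ⟨(pairSum (ζ ^ (1 + t₀.val * M)) a b - pairSum (ζ ^ (1 + t₀.val * M)) c d) / p,
    fun i => ?_⟩
  refine mul_left_cancel₀ hp' ?_
  rw [mul_sub, ← sum_range_mul_pairSum hp.pos hM hζ, ← sum_range_mul_pairSum hp.pos hM hζ,
    ← Finset.sum_sub_distrib, Finset.sum_eq_single_of_mem t₀.val]
  · rw [← mul_sub, ← zpow_mul]
    rw [show -(t₀.val : ℤ) * i = -(i * t₀.val) by ring]
    field_simp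
  · exact Finset.mem_range.mpr (ZMod.val_lt t₀)
  · intro t ht hne
    have hcop : (1 + t * M).Coprime (p * M) := by
      refine Nat.Coprime.mul_right ?_ ?_
      · rw [Nat.coprime_comm, hp.coprime_iff_not_dvd, ← ZMod.natCast_eq_zero_iff]
        intro h0
        apply hne
        have : (t : ZMod p) = t₀ := by
          push_cast at h0
          have h0' : (t : ZMod p) * M = -1 := by linear_combination h0
          rw [show t₀ = -1 * (M : ZMod p)⁻¹ by simp [t₀], ← h0', mul_assoc,
            mul_inv_cancel₀ hMp, mul_one]
        rw [← this, ZMod.val_natCast, Nat.mod_eq_of_lt (Finset.mem_range.mp ht)]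
      · simp
    rw [pairSum_pow_eq (Nat.mul_pos hp.pos hM) hζ hcop h, sub_self]

/-! ### Cosines and sums of two unit complex numbers -/

/-- The cosine of `2 * π * a / N`. -/
noncomputable def torusCos (N : ℕ) (a : ℤ) : ℝ :=
  Real.cos (2 * Real.pi * a / N)

/-- The standard primitive `N`-th root of unity. -/
noncomputable def torusRoot (N : ℕ) : ℂ :=
  Complex.exp (2 * Real.pi * Complex.I / N)

theorem isPrimitiveRoot_torusRoot {N : ℕ} (hN : 0 < N) : IsPrimitiveRoot (torusRoot N) N :=
  Complex.isPrimitiveRoot_exp N hN.ne'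

theorem torusRoot_zpow (N : ℕ) (a : ℤ) :
    torusRoot N ^ a = Complex.exp ((2 * Real.pi * a / N : ℝ) * Complex.I) := by
  rw [torusRoot, ← Complex.exp_int_mul]
  congr 1
  push_cast
  ring

theorem norm_torusRoot_zpow (N : ℕ) (a : ℤ) : ‖torusRoot N ^ a‖ = 1 := by
  rw [torusRoot_zpow, Complex.norm_exp_ofReal_mul_I]

theorem re_torusRoot_zpow (N : ℕ) (a : ℤ) : (torusRoot N ^ a).re = torusCos N a := by
  rw [torusRoot_zpow, Complex.exp_ofReal_mul_I_re, torusCos]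

theorem torusCos_neg (N : ℕ) (a : ℤ) : torusCos N (-a) = torusCos N a := by
  rw [torusCos, torusCos, ← Real.cos_neg]
  congr 1
  push_cast
  ring

theorem torusRoot_zpow_add_zpow_neg (N : ℕ) (a : ℤ) :
    torusRoot N ^ a + torusRoot N ^ (-a) = ((2 * torusCos N a : ℝ) : ℂ) := by
  rw [torusRoot_zpow, torusRoot_zpow, torusCos]
  push_cast
  rw [Complex.two_cos]
  congr 2
  ring

theorem pairSum_torusRoot (N : ℕ) (a b : ℤ) :
    pairSum (torusRoot N) a b = ((2 * torusCos N a + 2 * torusCos N b : ℝ) : ℂ) := by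
  rw [Complex.ofReal_add, ← torusRoot_zpow_add_zpow_neg, ← torusRoot_zpow_add_zpow_neg, pairSum]
  ring

theorem pairSum_torusRoot_eq_iff {N : ℕ} {a b c d : ℤ} :
    pairSum (torusRoot N) a b = pairSum (torusRoot N) c d ↔
      2 * torusCos N a + 2 * torusCos N b = 2 * torusCos N c + 2 * torusCos N d := by
  rw [pairSum_torusRoot, pairSum_torusRoot, Complex.ofReal_inj]

/-- Two complex numbers of modulus one with nonzero sum are determined by their sum. -/
theorem eq_or_eq_of_add_eq_add_of_norm_eq_one {u v w z : ℂ} (hu : ‖u‖ = 1) (hv : ‖v‖ = 1)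
    (hw : ‖w‖ = 1) (hz : ‖z‖ = 1) (h : u + v = w + z) (h0 : u + v ≠ 0) : w = u ∨ z = u := by
  have hinv : ∀ {x : ℂ}, ‖x‖ = 1 → x * (starRingEnd ℂ) x = 1 := by
    intro x hx
    rw [Complex.mul_conj, Complex.normSq_eq_norm_sq, hx]
    norm_num
  have hc := congrArg (starRingEnd ℂ) h
  rw [map_add, map_add] at hc
  -- Conjugation inverts unit numbers, so the conjugate of u + v times uv is u + v: a nonzero sum
  -- determines the product.
  have hprod : u * v = w * z := by
    have h1 : u * v * ((starRingEnd ℂ) u + (starRingEnd ℂ) v) = u + v := by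
      linear_combination v * hinv hu + u * hinv hv
    have h2 : w * z * ((starRingEnd ℂ) w + (starRingEnd ℂ) z) = w + z := by
      linear_combination z * hinv hw + w * hinv hz
    have h3 : (starRingEnd ℂ) u + (starRingEnd ℂ) v ≠ 0 := by
      rw [← map_add]
      exact (map_ne_zero _).mpr h0
    refine mul_right_cancel₀ h3 ?_
    rw [h1, h, ← h2, hc]
  have : (w - u) * (z - u) = 0 := by linear_combination -hprod + u * h
  rcases mul_eq_zero.mp this with h | h
  · exact Or.inl (sub_eq_zero.mp h)
  · exact Or.inr (sub_eq_zero.mp h)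

/-! ### Pairs sharing a nonzero component -/

/-- The pairs `(a, b)` and `(c, d)` agree up to order and signs. -/
def SamePair (a b c d : ℤ) : Prop :=
  ((c = a ∨ c = -a) ∧ (d = b ∨ d = -b)) ∨ ((c = b ∨ c = -b) ∧ (d = a ∨ d = -a))

theorem SamePair.pairComponent_eq {a b c d : ℤ} (h : SamePair a b c d) (q : ℕ) (ζ : ℂ) (i : ℤ) :
    pairComponent q ζ i c d = pairComponent q ζ i a b := by
  rcases h with ⟨rfl | rfl, rfl | rfl⟩ | ⟨rfl | rfl, rfl | rfl⟩ <;>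
    simp only [pairComponent, Int.cast_neg, neg_neg] <;> ring

theorem SamePair.torusCos_or {a b c d : ℤ} (h : SamePair a b c d) {N : ℕ} {P : ℝ → Prop}
    (hP : P (torusCos N c) ∨ P (torusCos N d)) : P (torusCos N a) ∨ P (torusCos N b) := by
  rcases h with ⟨rfl | rfl, rfl | rfl⟩ | ⟨rfl | rfl, rfl | rfl⟩ <;>
    simpa only [torusCos_neg, or_comm] using hP

theorem exists_samePair_of_pairComponent_ne_zero {q : ℕ} {ζ : ℂ} {i a b : ℤ}
    (h : pairComponent q ζ i a b ≠ 0) : ∃ c d, SamePair a b c d ∧ (c : ZMod q) = i := by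
  by_cases h1 : (a : ZMod q) = i
  · exact ⟨a, b, by simp [SamePair], h1⟩
  by_cases h2 : -(a : ZMod q) = i
  · exact ⟨-a, b, by simp [SamePair], by simpa using h2⟩
  by_cases h3 : (b : ZMod q) = i
  · exact ⟨b, a, by simp [SamePair], h3⟩
  by_cases h4 : -(b : ZMod q) = i
  · exact ⟨-b, a, by simp [SamePair], by simpa using h4⟩
  simp [pairComponent, h1, h2, h3, h4] at h

theorem pairComponent_of_ne {q : ℕ} {ζ : ℂ} {i a b : ℤ} (hi : (i : ZMod q) ≠ -i)
    (ha : (a : ZMod q) = i) (hb : (b : ZMod q) ≠ i) (hb' : (b : ZMod q) ≠ -i) :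
    pairComponent q ζ i a b = ζ ^ a := by
  have h1 : -(a : ZMod q) ≠ i := by rw [ha]; exact hi.symm
  have h2 : -(b : ZMod q) ≠ i := fun h => hb' (by rw [← h, neg_neg])
  simp [pairComponent, ha, hb, h2, hi.symm]

theorem pairComponent_of_eq {q : ℕ} {ζ : ℂ} {i a b : ℤ} (hi : (i : ZMod q) ≠ -i)
    (ha : (a : ZMod q) = i) (hb : (b : ZMod q) = i) :
    pairComponent q ζ i a b = ζ ^ a + ζ ^ b := by
  simp [pairComponent, ha, hb, hi.symm]

theorem pairComponent_eq_zero {q : ℕ} {ζ : ℂ} {i a b : ℤ} (ha : (a : ZMod q) ≠ i)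
    (ha' : (a : ZMod q) ≠ -i) (hb : (b : ZMod q) ≠ i) (hb' : (b : ZMod q) ≠ -i) :
    pairComponent q ζ i a b = 0 := by
  have h1 : -(a : ZMod q) ≠ i := fun h => ha' (by rw [← h, neg_neg])
  have h2 : -(b : ZMod q) ≠ i := fun h => hb' (by rw [← h, neg_neg])
  simp [pairComponent, ha, hb, h1, h2]

/-- The component is either a single root of unity or a sum of two whose real part is half the given
nonzero number. -/
theorem pairComponent_torusRoot_ne_zero {q N : ℕ} {i a b : ℤ}
    (hi : (i : ZMod q) ≠ -i) (ha : (a : ZMod q) = i)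
    (h0 : 2 * torusCos N a + 2 * torusCos N b ≠ 0) :
    pairComponent q (torusRoot N) i a b ≠ 0 := by
  have hsum : ∀ d : ℤ, torusCos N d = torusCos N b →
      torusRoot N ^ a + torusRoot N ^ d ≠ 0 := by
    intro d hd h
    have := congrArg Complex.re h
    rw [Complex.add_re, re_torusRoot_zpow, re_torusRoot_zpow, hd, Complex.zero_re] at this
    exact h0 (by linarith)
  by_cases hb : (b : ZMod q) = i
  · rw [pairComponent_of_eq hi ha hb]
    exact hsum b rfl
  by_cases hb' : (b : ZMod q) = -i
  · have hs : SamePair a b a (-b) := by simp [SamePair]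
    rw [← hs.pairComponent_eq, pairComponent_of_eq hi ha (by simp [hb'])]
    exact hsum (-b) (torusCos_neg N b)
  · rw [pairComponent_of_ne hi ha hb hb', ← norm_ne_zero_iff, norm_torusRoot_zpow]
    exact one_ne_zero

/-- All pairs with the same nonzero component share one of two cosines. -/
theorem exists_torusCos_of_pairComponent_eq {q : ℕ} (N : ℕ) {i : ℤ} (hi : (i : ZMod q) ≠ -i)
    {c : ℂ} (hc : c ≠ 0) : ∃ x y : ℝ, ∀ a b : ℤ, pairComponent q (torusRoot N) i a b = c →
      (torusCos N a = x ∨ torusCos N a = y) ∨ (torusCos N b = x ∨ torusCos N b = y) := by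
  -- The value y serves the pairs with two terms in the class i; those with a single term have
  -- cosine `c.re`.
  obtain ⟨y, hy⟩ : ∃ y : ℝ, ∀ a b : ℤ, (a : ZMod q) = i → (b : ZMod q) = i →
      pairComponent q (torusRoot N) i a b = c → torusCos N a = y ∨ torusCos N b = y := by
    by_cases hex : ∃ a₁ b₁ : ℤ, (a₁ : ZMod q) = i ∧ (b₁ : ZMod q) = i ∧
        pairComponent q (torusRoot N) i a₁ b₁ = c
    · obtain ⟨a₁, b₁, ha₁, hb₁, h₁⟩ := hex
      refine ⟨torusCos N a₁, fun a b ha hb h => ?_⟩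
      rw [pairComponent_of_eq hi ha₁ hb₁] at h₁
      rw [pairComponent_of_eq hi ha hb] at h
      rw [← re_torusRoot_zpow, ← re_torusRoot_zpow, ← re_torusRoot_zpow]
      rcases eq_or_eq_of_add_eq_add_of_norm_eq_one (norm_torusRoot_zpow N a₁)
        (norm_torusRoot_zpow N b₁) (norm_torusRoot_zpow N a) (norm_torusRoot_zpow N b)
        (h₁.trans h.symm) (h₁ ▸ hc) with h | h
      · exact Or.inl (by rw [h])
      · exact Or.inr (by rw [h])
    -- No such pair exists, so the value 0 is arbitrary.
    · exact ⟨0, fun a b ha hb h => absurd ⟨a, b, ha, hb, h⟩ hex⟩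
  refine ⟨c.re, y, fun a b h => ?_⟩
  obtain ⟨a', b', hs, ha'⟩ := exists_samePair_of_pairComponent_ne_zero (h ▸ hc)
  rw [← hs.pairComponent_eq] at h
  refine hs.torusCos_or (P := fun t => t = c.re ∨ t = y) ?_
  by_cases hb : (b' : ZMod q) = i
  · rcases hy a' b' ha' hb h with h | h <;> simp [h]
  by_cases hb' : (b' : ZMod q) = -i
  · have hs' : SamePair a' b' a' (-b') := by simp [SamePair]
    rw [← hs'.pairComponent_eq] at h
    have := hy a' (-b') ha' (by simp [hb']) h
    rw [torusCos_neg] at this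
    rcases this with h | h <;> simp [h]
  · rw [pairComponent_of_ne hi ha' hb hb'] at h
    left; left
    rw [← re_torusRoot_zpow, h]

/-! ### Small covers and their descent -/

/-- The representations of `μ` as a sum of two doubled cosines of multiples of `2 * π / N` all
involve one of at most three cosines. -/
def HasSmallCover (N : ℕ) (μ : ℝ) : Prop :=
  ∃ X : Finset ℝ, X.card ≤ 3 ∧ ∀ a b : ℤ, 2 * torusCos N a + 2 * torusCos N b = μ →
    torusCos N a ∈ X ∨ torusCos N b ∈ X

theorem torusCos_mul {p M : ℕ} (hp : 0 < p) (a : ℤ) :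
    torusCos (p * M) (p * a) = torusCos M a := by
  rw [torusCos, torusCos]
  congr 1
  push_cast
  have : (p : ℝ) ≠ 0 := by exact_mod_cast hp.ne'
  rw [mul_left_comm, mul_div_mul_left _ _ this]

theorem HasSmallCover.of_mul {p M : ℕ} (hp : 0 < p) {μ : ℝ} (h : HasSmallCover (p * M) μ) :
    HasSmallCover M μ := by
  obtain ⟨X, hX, h⟩ := h
  refine ⟨X, hX, fun a b hab => ?_⟩
  simpa only [torusCos_mul hp] using h (p * a) (p * b) (by simpa only [torusCos_mul hp] using hab)

/-- Swapping the summands makes the second exponent divisible as well, so each representation comes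
from level M. -/
theorem HasSmallCover.mul_of_forall_dvd {p M : ℕ} (hp : 0 < p) {μ : ℝ} (h : HasSmallCover M μ)
    (hdvd : ∀ a b : ℤ, 2 * torusCos (p * M) a + 2 * torusCos (p * M) b = μ → (p : ℤ) ∣ a) :
    HasSmallCover (p * M) μ := by
  obtain ⟨X, hX, h⟩ := h
  refine ⟨X, hX, fun a b hab => ?_⟩
  obtain ⟨a, rfl⟩ := hdvd a b hab
  obtain ⟨b, rfl⟩ := hdvd b _ (by rw [add_comm]; exact hab)
  simp only [torusCos_mul hp] at hab ⊢
  exact h a b hab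

/-- If components modulo `q` are well defined, a nonzero number with a representation that
involves a residue `i ≠ -i` has a small cover. -/
theorem hasSmallCover_of_coprime {q M : ℕ} (hq : 0 < q) (hM : 0 < M)
    (hcop : ∀ t, (1 + t * M).Coprime (q * M)) {μ : ℝ} (hμ : μ ≠ 0) {a₀ b₀ : ℤ}
    (h₀ : 2 * torusCos (q * M) a₀ + 2 * torusCos (q * M) b₀ = μ)
    (hi : (a₀ : ZMod q) ≠ -a₀) : HasSmallCover (q * M) μ := by
  have hζ := isPrimitiveRoot_torusRoot (Nat.mul_pos hq hM)
  obtain ⟨x, y, hxy⟩ := exists_torusCos_of_pairComponent_eq (q * M) hi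
    (pairComponent_torusRoot_ne_zero hi rfl (h₀ ▸ hμ))
  refine ⟨{x, y}, Finset.card_le_two.trans (by norm_num), fun a b hab => ?_⟩
  simpa using hxy a b (pairComponent_eq_of_coprime hq hM hζ hcop
    (pairSum_torusRoot_eq_iff.mpr (hab.trans h₀.symm)) a₀)

theorem ZMod.exists_ne_of_seven_le {p : ℕ} (hp : 7 ≤ p) (x y : ZMod p) :
    ∃ l : ℤ, (l : ZMod p) ≠ 0 ∧ (l : ZMod p) ≠ x ∧ (l : ZMod p) ≠ -x ∧
      (l : ZMod p) ≠ y ∧ (l : ZMod p) ≠ -y := by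
  have : NeZero p := ⟨by lia⟩
  have hcard : ({0, x, -x, y, -y} : Finset (ZMod p)).card < Fintype.card (ZMod p) := by
    rw [ZMod.card]
    exact Finset.card_le_five.trans_lt (by lia)
  obtain ⟨l, hl⟩ := Finset.exists_mem_notMem_of_card_lt_card
    (s := ({0, x, -x, y, -y} : Finset (ZMod p))) (t := Finset.univ) hcard
  obtain ⟨k, rfl⟩ := ZMod.intCast_surjective l
  simp only [Finset.mem_insert, Finset.mem_singleton, not_or] at hl
  exact ⟨k, hl.2⟩

/-- Since m ≠ 0, one of b, c is 0 and the other is ±m, and neither value meets ±l or ±a. -/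
theorem ne_of_eq_zero_or_of_eq_or {G : Type*} [AddCommGroup G] {a l m b c : G} (ha : a ≠ 0)
    (hl : l ≠ 0) (hm : m ≠ 0) (hma : m ≠ a) (hma' : m ≠ -a) (hml : m ≠ l) (hml' : m ≠ -l)
    (hzero : b = 0 ∨ c = 0) (hbc : (b = m ∨ b = -m) ∨ (c = m ∨ c = -m)) :
    (b ≠ l ∧ b ≠ -l) ∧ (b ≠ a ∧ b ≠ -a) ∧ (c ≠ a ∧ c ≠ -a) := by
  have ha' := ha.symm
  have hl' := hl.symm
  have hm' := hm.symm
  rcases hzero with rfl | rfl <;> rcases hbc with (h | h) | (h | h) <;>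
    simp_all [neg_eq_iff_eq_neg, eq_comm (a := (0 : G))]

theorem hasSmallCover_of_seven_le {p M : ℕ} (hp : p.Prime) (hp7 : 7 ≤ p) (hM : 0 < M)
    (hpM : ¬ p ∣ M) {μ : ℝ} (hμ : μ ≠ 0) {a₀ b₀ : ℤ}
    (h₀ : 2 * torusCos (p * M) a₀ + 2 * torusCos (p * M) b₀ = μ)
    (ha₀ : (a₀ : ZMod p) ≠ 0) : HasSmallCover (p * M) μ := by
  have := Fact.mk hp
  have hneg : ∀ {x : ZMod p}, x ≠ 0 → x ≠ -x := by
    intro x hx h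
    have h2 : (2 : ZMod p) * x = 0 := by linear_combination h
    have h2' : ((2 : ℕ) : ZMod p) ≠ 0 := by
      rw [Ne, ZMod.natCast_eq_zero_iff]
      exact fun h => absurd (Nat.le_of_dvd two_pos h) (by lia)
    exact (mul_ne_zero (by exact_mod_cast h2') hx) h2
  have hi := hneg ha₀
  have hζ := isPrimitiveRoot_torusRoot (Nat.mul_pos hp.pos hM)
  set ζ := torusRoot (p * M) with hζdef
  obtain ⟨x, y, hxy⟩ := exists_torusCos_of_pairComponent_eq (p * M) hi
    (pairComponent_torusRoot_ne_zero hi rfl (h₀ ▸ hμ))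
  obtain ⟨D, hD, hdiff⟩ := exists_pairComponent_sub_eq hp hM hpM hζ
  obtain ⟨l, hl0, hla, hla', hlb, hlb'⟩ := ZMod.exists_ne_of_seven_le hp7 (a₀ : ZMod p) b₀
  obtain ⟨m, hm0, hma, hma', hml, hml'⟩ := ZMod.exists_ne_of_seven_le hp7 (a₀ : ZMod p) l
  -- The third cosine serves the representations with C ≠ 0. It depends on the reference pair (a₀,
  -- b₀) and on l, not on (a, b).
  refine ⟨{x, y, (-(D ^ (l - a₀) * ζ ^ a₀)).re}, Finset.card_le_three, fun a b hab => ?_⟩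
  obtain ⟨C, hC⟩ := hdiff a b a₀ b₀ (pairSum_torusRoot_eq_iff.mpr (hab.trans h₀.symm))
  by_cases hC0 : C = 0
  · have hxy' := hxy a b (by
      have := hC a₀
      rw [hC0, mul_zero] at this
      exact sub_eq_zero.mp this)
    simp only [Finset.mem_insert, Finset.mem_singleton]
    tauto
  have hne : ∀ i : ℤ, D ^ i * C ≠ 0 := fun i => mul_ne_zero (zpow_ne_zero _ hD) hC0
  have hl₀ : pairComponent p ζ l a₀ b₀ = 0 :=
    pairComponent_eq_zero hla.symm (fun h => hla' (by rw [h, neg_neg])) hlb.symm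
      (fun h => hlb' (by rw [h, neg_neg]))
  have hl₁ := hC l
  rw [hl₀, sub_zero] at hl₁
  obtain ⟨a', b', hs, ha'⟩ := exists_samePair_of_pairComponent_ne_zero (hl₁ ▸ hne l)
  refine hs.torusCos_or (P := fun t => t ∈ ({x, y, (-(D ^ (l - a₀) * ζ ^ a₀)).re} : Finset ℝ))
    (Or.inl ?_)
  simp only [← hs.pairComponent_eq p ζ] at hC hl₁
  -- As C ≠ 0, the classes 0 and m must occur in one of the two pairs. Neither a' ≡ l nor a₀
  -- supplies them, so b' and b₀ do. The classes l and a₀ then contain one term each, and dividing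
  -- their equations eliminates C.
  have hzero : (b' : ZMod p) = 0 ∨ (b₀ : ZMod p) = 0 := by
    by_contra! h
    have := hC 0
    rw [pairComponent_eq_zero (by simpa [ha'] using hl0) (by simpa [ha'] using hl0)
      (by simpa using h.1) (by simpa using h.1), pairComponent_eq_zero (by simpa using ha₀)
      (by simpa using ha₀) (by simpa using h.2) (by simpa using h.2), sub_zero] at this
    exact hne 0 this.symm
  have hm : ((b' : ZMod p) = m ∨ (b' : ZMod p) = -m) ∨
      ((b₀ : ZMod p) = m ∨ (b₀ : ZMod p) = -m) := by
    by_contra! h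
    have := hC m
    rw [pairComponent_eq_zero (by rw [ha']; exact hml.symm)
      (by rw [ha']; exact fun h => hml' (by rw [h, neg_neg])) h.1.1 h.1.2,
      pairComponent_eq_zero hma.symm (fun h => hma' (by rw [h, neg_neg])) h.2.1 h.2.2,
      sub_zero] at this
    exact hne m this.symm
  have hb' : ((b' : ZMod p) ≠ l ∧ (b' : ZMod p) ≠ -l) ∧
      ((b' : ZMod p) ≠ a₀ ∧ (b' : ZMod p) ≠ -a₀) ∧
      ((b₀ : ZMod p) ≠ a₀ ∧ (b₀ : ZMod p) ≠ -a₀) :=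
    ne_of_eq_zero_or_of_eq_or ha₀ hl0 hm0 hma hma' hml hml' hzero hm
  obtain ⟨⟨hb1, hb2⟩, ⟨hb3, hb4⟩, hb5, hb6⟩ := hb'
  rw [pairComponent_of_ne (hneg hl0) ha' hb1 hb2] at hl₁
  have ha₁ := hC a₀
  rw [pairComponent_eq_zero (by rwa [ha']) (by rwa [ha']) hb3 hb4,
    pairComponent_of_ne hi rfl hb5 hb6, zero_sub] at ha₁
  have hval : ζ ^ a' = -(D ^ (l - a₀) * ζ ^ a₀) := by
    rw [hl₁, ← mul_neg, ha₁, ← mul_assoc, ← zpow_add₀ hD, sub_add_cancel]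
  rw [← re_torusRoot_zpow, ← hζdef, hval]
  simp
-- Level 60 via reduction modulo 601
/-- The residue modulo `601` of `441 ^ k + 441 ^ (-k)`, where `441` has order `60`. -/
def residueSixty (k : ℕ) : ℕ := (441 ^ k + 441 ^ (60 - k)) % 601
/-- The set of values of `residueSixty`, as a bit mask. -/
def residueMask : ℕ :=
  6353945715332117142180725754333539116523204209990788218802825390712494649401084427078715618402313473176478315375820878127547418022396897796382868094300486563040337403356877235945543

/-- Only this inclusion is needed: a superfluous bit could only increase the count below. -/
theorem testBit_residueMask :
    ∀ k ∈ Finset.range 31, residueMask.testBit (residueSixty k) = true := by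
  decide +kernel

/-- The inequality between the two residues keeps one member of each unordered representation of v.
-/
theorem card_filter_residue_le_three : ∀ v ∈ Finset.range 601, v ≠ 0 →
    ((Finset.range 31).filter fun k => residueSixty k ≤ (v + 601 - residueSixty k) % 601 ∧
      residueMask.testBit ((v + 601 - residueSixty k) % 601) = true).card ≤ 3 := by
  decide +kernel

/-- For k + l = 30 the cosines are opposite, so a nonzero `μ` has a nonzero residue. -/
theorem add_eq_thirty_of_residue : ∀ k ∈ Finset.range 31, ∀ l ∈ Finset.range 31,
    (residueSixty k + residueSixty l) % 601 = 0 → k + l = 30 := by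
  decide +kernel

theorem isPrimitiveRoot_zmod_601 : IsPrimitiveRoot (441 : ZMod 601) 60 := by
  have h : ∀ l ∈ Finset.range 60, 0 < l → (441 : ZMod 601) ^ l ≠ 1 := by decide +kernel
  exact IsPrimitiveRoot.mk_of_lt _ (by norm_num) (by decide +kernel)
    fun l hl hlt => h l (Finset.mem_range.mpr hlt) hl

theorem prime_601 : Nat.Prime 601 := by norm_num

theorem natCast_residueSixty [Fact (Nat.Prime 601)] {k : ℕ} (hk : k ≤ 30) :
    ((residueSixty k : ℕ) : ZMod 601) = 441 ^ (k : ℤ) + 441 ^ (-(k : ℤ)) := by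
  have h : (441 : ZMod 601) ^ (60 - k) * 441 ^ k = 1 := by
    rw [← pow_add, Nat.sub_add_cancel (by lia), isPrimitiveRoot_zmod_601.pow_eq_one]
  rw [zpow_neg, zpow_natCast, ← eq_inv_of_mul_eq_one_left h, residueSixty]
  rw [ZMod.natCast_mod]
  push_cast
  rfl

theorem torusCos_add_mul {N : ℕ} (hN : 0 < N) (a j : ℤ) :
    torusCos N (a + N * j) = torusCos N a := by
  rw [torusCos, torusCos, ← Real.cos_add_int_mul_two_pi (2 * Real.pi * a / N) j]
  congr 1
  have : (N : ℝ) ≠ 0 := by exact_mod_cast hN.ne'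
  push_cast
  field_simp

theorem exists_torusCos_sixty_eq (a : ℤ) : ∃ k : ℕ, k ≤ 30 ∧ torusCos 60 a = torusCos 60 k := by
  have ha := Int.emod_add_mul_ediv a 60
  have h0 := Int.emod_nonneg a (show (60 : ℤ) ≠ 0 by norm_num)
  have h1 := Int.emod_lt_of_pos a (show (0 : ℤ) < 60 by norm_num)
  have hc : torusCos 60 a = torusCos 60 (a % 60) := by
    conv_lhs => rw [← ha]
    exact torusCos_add_mul (by norm_num) _ _
  rcases le_total (a % 60) 30 with h | h
  · exact ⟨(a % 60).toNat, by lia, by rw [hc, Int.toNat_of_nonneg h0]⟩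
  · refine ⟨(60 - a % 60).toNat, by lia, ?_⟩
    rw [hc, Int.toNat_of_nonneg (by lia), ← torusCos_neg 60 (60 - a % 60),
      ← torusCos_add_mul (show 0 < 60 by norm_num) (-(60 - a % 60)) 1]
    congr 1
    push_cast
    ring

theorem residueSixty_add_mod_eq {k l m n : ℕ} (hk : k ≤ 30) (hl : l ≤ 30) (hm : m ≤ 30)
    (hn : n ≤ 30) (h : 2 * torusCos 60 k + 2 * torusCos 60 l =
      2 * torusCos 60 m + 2 * torusCos 60 n) :
    (residueSixty k + residueSixty l) % 601 = (residueSixty m + residueSixty n) % 601 := by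
  have := Fact.mk prime_601
  have h601 := pairSum_eq_of_isRoot_cyclotomic (by norm_num)
    (isPrimitiveRoot_torusRoot (show 0 < 60 by norm_num))
    (isPrimitiveRoot_zmod_601.isRoot_cyclotomic (by norm_num)) (pairSum_torusRoot_eq_iff.mpr h)
  have hval : ∀ {x y : ℕ}, x ≤ 30 → y ≤ 30 → pairSum (441 : ZMod 601) x y =
      ((residueSixty x + residueSixty y : ℕ) : ZMod 601) := by
    intro x y hx hy
    rw [Nat.cast_add, natCast_residueSixty hx, natCast_residueSixty hy, pairSum]
    ring
  rw [hval hk hl, hval hm hn] at h601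
  exact (ZMod.natCast_eq_natCast_iff' _ _ _).mp h601

theorem residueSixty_lt (k : ℕ) : residueSixty k < 601 := Nat.mod_lt _ (by norm_num)

theorem hasSmallCover_sixty {μ : ℝ} (hμ : μ ≠ 0) : HasSmallCover 60 μ := by
  by_cases hex : ∃ a b : ℤ, 2 * torusCos 60 a + 2 * torusCos 60 b = μ
  swap
  · exact ⟨∅, by simp, fun a b h => absurd ⟨a, b, h⟩ hex⟩
  obtain ⟨a₀, b₀, h₀⟩ := hex
  obtain ⟨k₀, hk₀, hak₀⟩ := exists_torusCos_sixty_eq a₀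
  obtain ⟨l₀, hl₀, hbl₀⟩ := exists_torusCos_sixty_eq b₀
  rw [hak₀, hbl₀] at h₀
  set v := (residueSixty k₀ + residueSixty l₀) % 601 with hv
  have hv0 : v ≠ 0 := by
    intro h
    have hkl := add_eq_thirty_of_residue k₀ (Finset.mem_range.mpr (by lia)) l₀
      (Finset.mem_range.mpr (by lia)) h
    apply hμ
    have : torusCos 60 l₀ = -torusCos 60 k₀ := by
      rw [torusCos, torusCos, ← Real.cos_pi_sub]
      congr 1
      have : (k₀ : ℝ) + l₀ = 30 := by exact_mod_cast hkl
      push_cast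
      rw [show (l₀ : ℝ) = 30 - k₀ by linarith]
      ring
    rw [← h₀, this]
    ring
  refine ⟨((Finset.range 31).filter fun k => residueSixty k ≤ (v + 601 - residueSixty k) % 601 ∧
      residueMask.testBit ((v + 601 - residueSixty k) % 601) = true).image
      fun k : ℕ => torusCos 60 k, Finset.card_image_le.trans
      (card_filter_residue_le_three v (Finset.mem_range.mpr (Nat.mod_lt _ (by norm_num))) hv0),
    fun a b hab => ?_⟩
  obtain ⟨k, hk, hak⟩ := exists_torusCos_sixty_eq a
  obtain ⟨l, hl, hbl⟩ := exists_torusCos_sixty_eq b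
  rw [hak, hbl] at hab ⊢
  have hkl := residueSixty_add_mod_eq hk hl hk₀ hl₀ (hab.trans h₀.symm)
  rw [← hv] at hkl
  have hmem : ∀ {x y : ℕ}, x ≤ 30 → y ≤ 30 → (residueSixty x + residueSixty y) % 601 = v →
      residueSixty x ≤ residueSixty y → torusCos 60 x ∈
        ((Finset.range 31).filter fun k => residueSixty k ≤ (v + 601 - residueSixty k) % 601 ∧
          residueMask.testBit ((v + 601 - residueSixty k) % 601) = true).image
          fun k : ℕ => torusCos 60 k := by
    intro x y hx hy hxy hle
    have hw : (v + 601 - residueSixty x) % 601 = residueSixty y := by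
      have := residueSixty_lt x
      have := residueSixty_lt y
      lia
    refine Finset.mem_image_of_mem _ (Finset.mem_filter.mpr
      ⟨Finset.mem_range.mpr (by lia), ?_⟩)
    rw [hw]
    exact ⟨hle, testBit_residueMask y (Finset.mem_range.mpr (by lia))⟩
  rcases le_total (residueSixty k) (residueSixty l) with h | h
  · exact Or.inl (hmem hk hl hkl h)
  · exact Or.inr (hmem hl hk (by rwa [add_comm]) h)

/-! ### Induction on N -/

theorem Nat.coprime_one_add_mul_of_dvd {q M : ℕ} (h : q ∣ M) (t : ℕ) :
    (1 + t * M).Coprime (q * M) := by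
  have hM : (1 + t * M).Coprime M := by simp
  exact Nat.Coprime.mul_right (Nat.Coprime.coprime_dvd_right h hM) hM

theorem ZMod.ne_neg_self_of_not_dvd {p : ℕ} (hp : p.Prime) (hp2 : p ≠ 2) {a : ℤ}
    (ha : ¬ (p : ℤ) ∣ a) : (a : ZMod p) ≠ -a := by
  have := Fact.mk hp
  intro h
  have h2 : ((2 * a : ℤ) : ZMod p) = 0 := by
    push_cast
    linear_combination h
  rw [ZMod.intCast_zmod_eq_zero_iff_dvd] at h2
  rcases (Nat.prime_iff_prime_int.mp hp).dvd_or_dvd h2 with h | h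
  · exact hp2 ((Nat.prime_dvd_prime_iff_eq hp Nat.prime_two).mp (by exact_mod_cast h))
  · exact ha h

theorem hasSmallCover_mul_of_dvd {p M : ℕ} (hp : p.Prime) (hp2 : p ≠ 2) (hM : 0 < M)
    (hpM : p ∣ M) {μ : ℝ} (hμ : μ ≠ 0) (ih : HasSmallCover M μ) : HasSmallCover (p * M) μ := by
  by_cases hex : ∃ a b : ℤ, 2 * torusCos (p * M) a + 2 * torusCos (p * M) b = μ ∧ ¬ (p : ℤ) ∣ a
  · obtain ⟨a, b, h, ha⟩ := hex
    exact hasSmallCover_of_coprime hp.pos hM (Nat.coprime_one_add_mul_of_dvd hpM) hμ h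
      (ZMod.ne_neg_self_of_not_dvd hp hp2 ha)
  · push Not at hex
    exact ih.mul_of_forall_dvd hp.pos hex

theorem hasSmallCover_mul_of_not_dvd {p M : ℕ} (hp : p.Prime) (hp7 : 7 ≤ p) (hM : 0 < M)
    (hpM : ¬ p ∣ M) {μ : ℝ} (hμ : μ ≠ 0) (ih : HasSmallCover M μ) : HasSmallCover (p * M) μ := by
  by_cases hex : ∃ a b : ℤ, 2 * torusCos (p * M) a + 2 * torusCos (p * M) b = μ ∧ ¬ (p : ℤ) ∣ a
  · obtain ⟨a, b, h, ha⟩ := hex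
    exact hasSmallCover_of_seven_le hp hp7 hM hpM hμ h
      (by rwa [Ne, ZMod.intCast_zmod_eq_zero_iff_dvd])
  · push Not at hex
    exact ih.mul_of_forall_dvd hp.pos hex

theorem hasSmallCover_eight_mul {M : ℕ} (hM : 0 < M) {μ : ℝ} (hμ : μ ≠ 0)
    (ih : HasSmallCover (4 * M) μ) : HasSmallCover (8 * M) μ := by
  by_cases hex : ∃ a b : ℤ, 2 * torusCos (8 * M) a + 2 * torusCos (8 * M) b = μ ∧ ¬ (2 : ℤ) ∣ a
  · obtain ⟨a, b, h, ha⟩ := hex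
    -- Modulo 2 every class is its own negative; modulo 4 the odd classes are not, and 1 + 2tM is
    -- always odd.
    rw [show 8 * M = 4 * (2 * M) by ring] at h ⊢
    refine hasSmallCover_of_coprime (by norm_num) (by lia) (fun t => ?_) hμ h fun h' => ?_
    · have h2M : (1 + t * (2 * M)).Coprime (2 * M) := by simp
      have h2 : (1 + t * (2 * M)).Coprime 2 :=
        Nat.Coprime.coprime_dvd_right (dvd_mul_right 2 M) h2M
      exact Nat.Coprime.mul_right (Nat.Coprime.mul_right h2 h2) h2M
    · have h4 : ((2 * a : ℤ) : ZMod 4) = 0 := by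
        push_cast
        linear_combination h'
      rw [ZMod.intCast_zmod_eq_zero_iff_dvd] at h4
      lia
  · push Not at hex
    rw [show 8 * M = 2 * (4 * M) by ring] at hex ⊢
    exact ih.mul_of_forall_dvd two_pos hex

/-- As 60 = 4·3·5, a number with none of the reducible factors divides 60. -/
theorem Nat.dvd_sixty_or {N : ℕ} :
    N ∣ 60 ∨ 8 ∣ N ∨ 3 * 3 ∣ N ∨ 5 * 5 ∣ N ∨ ∃ p, p.Prime ∧ 7 ≤ p ∧ p ∣ N := by
  by_contra! h
  obtain ⟨h60, h8, h9, h25, h7⟩ := h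
  refine h60 ((Nat.dvd_iff_prime_pow_dvd_dvd 60 N).mpr fun p k hp hpk => ?_)
  rcases Nat.eq_zero_or_pos k with rfl | hk
  · simp
  have hp7 : p < 7 := by
    by_contra! hge
    exact h7 p hp hge ((dvd_pow_self p hk.ne').trans hpk)
  have hle : ∀ {j : ℕ}, ¬ p ^ (j + 1) ∣ N → k ≤ j := by
    intro j hj
    by_contra! hlt
    exact hj ((pow_dvd_pow p hlt).trans hpk)
  interval_cases p
  · exact absurd hp (by norm_num)
  · exact absurd hp (by norm_num)
  · exact (pow_dvd_pow 2 (hle (j := 2) h8)).trans (by norm_num)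
  · exact (pow_dvd_pow 3 (hle (j := 1) h9)).trans (by norm_num)
  · exact absurd hp (by norm_num)
  · exact (pow_dvd_pow 5 (hle (j := 1) h25)).trans (by norm_num)
  · exact absurd hp (by norm_num)

theorem hasSmallCover {N : ℕ} (hN : 0 < N) {μ : ℝ} (hμ : μ ≠ 0) : HasSmallCover N μ := by
  induction N using Nat.strong_induction_on with
  | _ N ih =>
  have odd_case : ∀ {p : ℕ}, p.Prime → p ≠ 2 → p * p ∣ N → HasSmallCover N μ := by
    rintro p hp hp2 ⟨M, rfl⟩
    rw [mul_assoc] at hN ih ⊢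
    have hM : 0 < p * M := pos_of_mul_pos_right hN (Nat.zero_le _)
    exact hasSmallCover_mul_of_dvd hp hp2 hM (dvd_mul_right p M) hμ
      (ih _ (lt_mul_of_one_lt_left hM hp.one_lt) hM)
  rcases Nat.dvd_sixty_or (N := N) with ⟨p, hp⟩ | ⟨M, rfl⟩ | h | h | ⟨p, hp, hp7, hpN⟩
  · refine HasSmallCover.of_mul (p := p) (by lia) ?_
    rw [mul_comm, ← hp]
    exact hasSmallCover_sixty hμ
  · exact hasSmallCover_eight_mul (by lia) hμ (ih _ (by lia) (by lia))
  · exact odd_case Nat.prime_three (by norm_num) h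
  · exact odd_case Nat.prime_five (by norm_num) h
  · by_cases hpp : p * p ∣ N
    · exact odd_case hp (by lia) hpp
    obtain ⟨M, rfl⟩ := hpN
    have hM : 0 < M := pos_of_mul_pos_right hN (Nat.zero_le _)
    exact hasSmallCover_mul_of_not_dvd hp hp7 hM (fun h => hpp (mul_dvd_mul_left p h)) hμ
      (ih _ (lt_mul_of_one_lt_left hM hp.one_lt) hM)

/-! ### Diagonalisation and the count of eigenvalues -/

/-- The cosine attached to a residue modulo `N`. -/
noncomputable def zmodCos {N : ℕ} (k : ZMod N) : ℝ := torusCos N k.val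

theorem torusEigenvalue_eq (N : ℕ) (k₁ k₂ : ZMod N) :
    torusEigenvalue N k₁ k₂ = 2 * zmodCos k₁ + 2 * zmodCos k₂ := by
  simp only [torusEigenvalue, zmodCos, torusCos, Int.cast_natCast, mul_right_comm]

theorem stdAddChar_intCast_eq {N : ℕ} [NeZero N] (a : ℤ) :
    ZMod.stdAddChar (a : ZMod N) = torusRoot N ^ a := by
  rw [ZMod.stdAddChar_coe, torusRoot_zpow]
  congr 1
  push_cast
  ring

theorem stdAddChar_eq {N : ℕ} [NeZero N] (k : ZMod N) :
    ZMod.stdAddChar k = torusRoot N ^ (k.val : ℤ) := by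
  rw [← stdAddChar_intCast_eq]
  simp

theorem stdAddChar_neg_eq {N : ℕ} [NeZero N] (k : ZMod N) :
    ZMod.stdAddChar (-k) = torusRoot N ^ (-(k.val : ℤ)) := by
  rw [← stdAddChar_intCast_eq]
  simp

theorem stdAddChar_add_neg {N : ℕ} [NeZero N] (k : ZMod N) :
    ZMod.stdAddChar k + ZMod.stdAddChar (-k) = ((2 * zmodCos k : ℝ) : ℂ) := by
  rw [stdAddChar_eq, stdAddChar_neg_eq, torusRoot_zpow_add_zpow_neg, zmodCos]

theorem stdAddChar_mul_neg {N : ℕ} [NeZero N] (k : ZMod N) :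
    (ZMod.stdAddChar k : ℂ) * ZMod.stdAddChar (-k) = 1 := by
  rw [← AddChar.map_add_eq_mul, add_neg_cancel, AddChar.map_zero_eq_one]

theorem zmodCos_eq_iff {N : ℕ} [NeZero N] {k l : ZMod N} :
    zmodCos k = zmodCos l ↔ k = l ∨ k = -l := by
  constructor
  · intro h
    have hsum : (ZMod.stdAddChar k : ℂ) + ZMod.stdAddChar (-k) =
        ZMod.stdAddChar l + ZMod.stdAddChar (-l) := by
      rw [stdAddChar_add_neg, stdAddChar_add_neg, h]
    have hprod : ((ZMod.stdAddChar k : ℂ) - ZMod.stdAddChar l) *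
        (ZMod.stdAddChar k - ZMod.stdAddChar (-l)) = 0 := by
      linear_combination ZMod.stdAddChar k * hsum + stdAddChar_mul_neg l - stdAddChar_mul_neg k
    rcases mul_eq_zero.mp hprod with h | h
    · exact Or.inl (ZMod.injective_stdAddChar (sub_eq_zero.mp h))
    · exact Or.inr (ZMod.injective_stdAddChar (sub_eq_zero.mp h))
  · rintro (rfl | rfl)
    · rfl
    · have h : ((2 * zmodCos (-l) : ℝ) : ℂ) = ((2 * zmodCos l : ℝ) : ℂ) := by
        rw [← stdAddChar_add_neg, ← stdAddChar_add_neg, neg_neg, add_comm]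
      linarith [Complex.ofReal_injective h]

/-- The matrix of characters of `ℤ/N × ℤ/N`. -/
noncomputable def torusCharMatrix (N : ℕ) [NeZero N] :
    Matrix (ZMod N × ZMod N) (ZMod N × ZMod N) ℂ :=
  fun x k => ZMod.stdAddChar (x.1 * k.1 + x.2 * k.2)

/-- The inverse of `torusCharMatrix`. -/
noncomputable def torusCharMatrixInv (N : ℕ) [NeZero N] :
    Matrix (ZMod N × ZMod N) (ZMod N × ZMod N) ℂ :=
  fun k x => (N : ℂ)⁻¹ ^ 2 * ZMod.stdAddChar (-(x.1 * k.1 + x.2 * k.2))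

theorem torusCharMatrixInv_mul (N : ℕ) [NeZero N] :
    torusCharMatrixInv N * torusCharMatrix N = 1 := by
  ext k l
  have hN : (N : ℂ) ≠ 0 := by exact_mod_cast NeZero.ne N
  have hterm : ∀ x : ZMod N × ZMod N, torusCharMatrixInv N k x * torusCharMatrix N x l =
      (N : ℂ)⁻¹ ^ 2 * (ZMod.stdAddChar (x.1 * (l.1 - k.1)) *
        ZMod.stdAddChar (x.2 * (l.2 - k.2))) := by
    intro x
    rw [torusCharMatrixInv, torusCharMatrix, mul_assoc, ← AddChar.map_add_eq_mul,
      ← AddChar.map_add_eq_mul]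
    congr 2
    ring
  simp only [Matrix.mul_apply, hterm]
  rw [← Finset.mul_sum, Fintype.sum_prod_type]
  simp only [← Finset.mul_sum]
  rw [← Finset.sum_mul, AddChar.sum_mulShift _ (ZMod.isPrimitive_stdAddChar N),
    AddChar.sum_mulShift _ (ZMod.isPrimitive_stdAddChar N), Matrix.one_apply, ZMod.card]
  simp only [sub_eq_zero, Prod.ext_iff, eq_comm (a := k.1), eq_comm (a := k.2)]
  by_cases h1 : l.1 = k.1 <;> by_cases h2 : l.2 = k.2 <;> simp [h1, h2]
  field_simp

theorem discreteTorus_adj_iff {N : ℕ} (hN : 3 ≤ N) (x y : ZMod N × ZMod N) :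
    (discreteTorus N).Adj x y ↔
      y ∈ ({x + (0, 1), x + (0, -1), x + (1, 0), x + (-1, 0)} : Finset (ZMod N × ZMod N)) := by
  have : Fact (1 < N) := ⟨by lia⟩
  rw [discreteTorus, SimpleGraph.addCayley_adj']
  simp only [Set.mem_insert_iff, Set.mem_singleton_iff, Finset.mem_insert, Finset.mem_singleton]
  constructor
  · rintro ⟨-, g, rfl | rfl | rfl | rfl, rfl | rfl⟩ <;> simp [add_assoc]
  · rintro (rfl | rfl | rfl | rfl) <;> exact ⟨by simp [Prod.ext_iff], _, by simp, Or.inl rfl⟩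

theorem map_torusAdjMatrix_mul_torusCharMatrix {N : ℕ} [NeZero N] (hN : 3 ≤ N) :
    (torusAdjMatrix N).map (algebraMap ℝ ℂ) * torusCharMatrix N =
      torusCharMatrix N *
        Matrix.diagonal fun k => algebraMap ℝ ℂ (torusEigenvalue N k.1 k.2) := by
  classical
  have : Fact (2 < N) := ⟨hN⟩
  have : Fact (1 < N) := ⟨by lia⟩
  -- This is where N ≥ 3 enters: the four neighbours are distinct, so each generator contributes its
  -- own term.
  have hne : (1 : ZMod N) ≠ -1 := (ZMod.neg_one_ne_one).symm
  ext x k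
  rw [Matrix.mul_diagonal, Matrix.mul_apply]
  have hentry : ∀ y, (torusAdjMatrix N).map (algebraMap ℝ ℂ) x y * torusCharMatrix N y k =
      if y ∈ ({x + (0, 1), x + (0, -1), x + (1, 0), x + (-1, 0)} : Finset (ZMod N × ZMod N))
        then torusCharMatrix N y k else 0 := by
    intro y
    rw [Matrix.map_apply, torusAdjMatrix, SimpleGraph.adjMatrix_apply]
    simp only [discreteTorus_adj_iff hN]
    split_ifs <;> simp
  simp only [hentry]
  rw [Finset.sum_ite_mem, Finset.univ_inter, Finset.sum_insert (by simp [hne]),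
    Finset.sum_insert (by simp), Finset.sum_insert (by simp [hne]), Finset.sum_singleton]
  have hshift : ∀ s : ZMod N × ZMod N, torusCharMatrix N (x + s) k =
      torusCharMatrix N x k * ZMod.stdAddChar (s.1 * k.1 + s.2 * k.2) := by
    intro s
    change ZMod.stdAddChar _ = ZMod.stdAddChar _ * ZMod.stdAddChar _
    rw [← AddChar.map_add_eq_mul]
    congr 1
    simp only [Prod.fst_add, Prod.snd_add]
    ring
  rw [hshift, hshift, hshift, hshift, torusEigenvalue_eq, Complex.coe_algebraMap,
    Complex.ofReal_add, ← stdAddChar_add_neg, ← stdAddChar_add_neg]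
  simp only [zero_mul, one_mul, neg_mul, zero_add, add_zero]
  ring

open Polynomial in
theorem charpoly_torusAdjMatrix {N : ℕ} [NeZero N] (hN : 3 ≤ N) :
    (torusAdjMatrix N).charpoly =
      ∏ k : ZMod N × ZMod N, (X - C (torusEigenvalue N k.1 k.2)) := by
  refine Polynomial.map_injective (algebraMap ℝ ℂ) (algebraMap ℝ ℂ).injective ?_
  rw [← Matrix.charpoly_map]
  have hinv := torusCharMatrixInv_mul N
  have hinv' : torusCharMatrix N * torusCharMatrixInv N = 1 := mul_eq_one_comm.mp hinv
  have hA : (torusAdjMatrix N).map (algebraMap ℝ ℂ) = torusCharMatrix N *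
      ((Matrix.diagonal fun k => algebraMap ℝ ℂ (torusEigenvalue N k.1 k.2)) *
        torusCharMatrixInv N) := by
    rw [← mul_assoc, ← map_torusAdjMatrix_mul_torusCharMatrix hN, mul_assoc, hinv', mul_one]
  rw [hA, Matrix.charpoly_mul_comm, mul_assoc, hinv, mul_one, Matrix.charpoly_diagonal,
    Polynomial.map_prod]
  simp

theorem torusMultiplicity_eq_card {N : ℕ} [NeZero N] (hN : 3 ≤ N) (μ : ℝ) :
    torusMultiplicity N μ = (Finset.univ.filter fun k : ZMod N × ZMod N =>
      2 * zmodCos k.1 + 2 * zmodCos k.2 = μ).card := by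
  classical
  rw [torusMultiplicity, charpoly_torusAdjMatrix hN, ← Polynomial.count_roots,
    Polynomial.roots_prod _ _ (Polynomial.monic_prod_X_sub_C _ _).ne_zero]
  simp only [Polynomial.roots_X_sub_C, Multiset.bind_singleton, Multiset.count_map,
    torusEigenvalue_eq, eq_comm (a := μ)]
  rfl

theorem card_filter_zmodCos_le_two {N : ℕ} [NeZero N] (x : ℝ) :
    (Finset.univ.filter fun k : ZMod N => zmodCos k = x).card ≤ 2 := by
  by_cases hex : ∃ l : ZMod N, zmodCos l = x
  · obtain ⟨l, rfl⟩ := hex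
    refine (Finset.card_le_card (t := {l, -l}) fun k hk => ?_).trans Finset.card_le_two
    simpa [zmodCos_eq_iff] using hk
  · push Not at hex
    simp [hex]

/-- A cosine x in the cover forces the other to be μ/2 - x; two orders and at most two residues per
cosine give 8 pairs for each x. -/
theorem HasSmallCover.card_filter_le {N : ℕ} [NeZero N] {μ : ℝ} (h : HasSmallCover N μ) :
    (Finset.univ.filter fun k : ZMod N × ZMod N =>
      2 * zmodCos k.1 + 2 * zmodCos k.2 = μ).card ≤ 24 := by
  classical
  obtain ⟨X, hX, h⟩ := h
  let fib : ℝ → Finset (ZMod N) := fun x => Finset.univ.filter fun k => zmodCos k = x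
  have hsub : (Finset.univ.filter fun k : ZMod N × ZMod N =>
      2 * zmodCos k.1 + 2 * zmodCos k.2 = μ) ⊆
      X.biUnion fun x => fib x ×ˢ fib (μ / 2 - x) ∪ fib (μ / 2 - x) ×ˢ fib x := by
    rintro ⟨k, l⟩ hkl
    have hkl' : 2 * zmodCos k + 2 * zmodCos l = μ := by simpa using hkl
    rw [Finset.mem_biUnion]
    rcases h _ _ hkl' with hx | hx
    · refine ⟨_, hx, Finset.mem_union_left _ ?_⟩
      simp only [fib, Finset.mem_product, Finset.mem_filter, Finset.mem_univ, true_and]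
      exact ⟨rfl, by change _ = μ / 2 - zmodCos k; linarith⟩
    · refine ⟨_, hx, Finset.mem_union_right _ ?_⟩
      simp only [fib, Finset.mem_product, Finset.mem_filter, Finset.mem_univ, true_and]
      exact ⟨by change _ = μ / 2 - zmodCos l; linarith, rfl⟩
  have hfib : ∀ x y, (fib x ×ˢ fib y).card ≤ 4 := by
    intro x y
    rw [Finset.card_product]
    exact Nat.mul_le_mul (card_filter_zmodCos_le_two x) (card_filter_zmodCos_le_two y)
  calc _ ≤ _ := Finset.card_le_card hsub
    _ ≤ X.card * 8 := Finset.card_biUnion_le_card_mul _ _ _ fun x _ =>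
        (Finset.card_union_le _ _).trans (Nat.add_le_add (hfib _ _) (hfib _ _))
    _ ≤ 24 := by lia

theorem torusMultiplicity_le {N : ℕ} [NeZero N] (hN : 3 ≤ N) {μ : ℝ} (hμ : μ ≠ 0) :
    torusMultiplicity N μ ≤ 24 := by
  rw [torusMultiplicity_eq_card hN]
  exact (hasSmallCover (by lia) hμ).card_filter_le

/-! ### An eigenvalue of multiplicity 24 -/

theorem zmodCos_sixty_ten : zmodCos (10 : ZMod 60) = 1 / 2 := by
  rw [zmodCos, torusCos, ← Real.cos_pi_div_three, show (10 : ZMod 60).val = 10 from rfl]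
  congr 1
  push_cast
  ring

theorem zmodCos_sixty_fifteen : zmodCos (15 : ZMod 60) = 0 := by
  rw [zmodCos, torusCos, ← Real.cos_pi_div_two, show (15 : ZMod 60).val = 15 from rfl]
  congr 1
  push_cast
  ring

theorem zmodCos_sixty_twentyFour : zmodCos (24 : ZMod 60) = -(1 + √5) / 4 := by
  rw [zmodCos, torusCos, neg_div, ← Real.cos_pi_div_five, ← Real.cos_pi_sub,
    show (24 : ZMod 60).val = 24 from rfl]
  congr 1
  push_cast
  ring

theorem zmodCos_sixty_eighteen : zmodCos (18 : ZMod 60) = (1 - √5) / 4 := by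
  have h : zmodCos (18 : ZMod 60) = -Real.cos (2 * (Real.pi / 5)) := by
    rw [zmodCos, torusCos, ← Real.cos_pi_sub, show (18 : ZMod 60).val = 18 from rfl]
    congr 1
    push_cast
    ring
  rw [h, Real.cos_two_mul, Real.cos_pi_div_five]
  have h5 : √5 ^ 2 = 5 := Real.sq_sqrt (by norm_num)
  linear_combination (-1 / 8) * h5

/-- With θ = 2π·18/60, the angles are θ ∓ π/3, and cos(θ - π/3) + cos(θ + π/3) = cos θ. -/
theorem zmodCos_sixty_eight_add :
    zmodCos (8 : ZMod 60) + zmodCos (28 : ZMod 60) = zmodCos (18 : ZMod 60) := by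
  set θ : ℝ := 2 * Real.pi * ((18 : ℕ) : ℤ) / (60 : ℕ) with hθ
  have h18 : zmodCos (18 : ZMod 60) = Real.cos θ := rfl
  have h8 : zmodCos (8 : ZMod 60) = Real.cos (θ - Real.pi / 3) := by
    rw [zmodCos, torusCos, show (8 : ZMod 60).val = 8 from rfl, hθ]
    congr 1
    push_cast
    ring
  have h28 : zmodCos (28 : ZMod 60) = Real.cos (θ + Real.pi / 3) := by
    rw [zmodCos, torusCos, show (28 : ZMod 60).val = 28 from rfl, hθ]
    congr 1
    push_cast
    ring
  rw [h18, h8, h28, Real.cos_add, Real.cos_sub, Real.cos_pi_div_three]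
  ring

theorem torusEigenvalue_sixty : torusEigenvalue 60 24 10 = (1 - √5) / 2 := by
  rw [torusEigenvalue_eq, zmodCos_sixty_ten, zmodCos_sixty_twentyFour]
  ring

theorem torusEigenvalue_sixty_ne_zero : torusEigenvalue 60 24 10 ≠ 0 := by
  rw [torusEigenvalue_sixty]
  have h : (1 : ℝ) < √5 := by
    rw [Real.lt_sqrt zero_le_one]
    norm_num
  have : (1 - √5) / 2 < 0 := by linarith
  exact this.ne

/-- Up to order, the pairs of residues modulo `60` whose eigenvalue is
`(1 - √5) / 2`. -/
def sixtyPairs : Finset (ZMod 60 × ZMod 60) :=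
  {24, -24} ×ˢ {10, -10} ∪ {18, -18} ×ˢ {15, -15} ∪ {8, -8} ×ˢ {28, -28}

theorem le_torusMultiplicity_sixty :
    24 ≤ torusMultiplicity 60 (torusEigenvalue 60 24 10) := by
  rw [torusMultiplicity_eq_card (by norm_num)]
  -- Three pairs, four sign choices and two orders; the six residues are distinct up to sign and
  -- none equals its negative.
  have hcard : (sixtyPairs ∪ sixtyPairs.image Prod.swap).card = 24 := by decide +kernel
  rw [← hcard]
  have hneg : ∀ k : ZMod 60, zmodCos (-k) = zmodCos k := fun k => zmodCos_eq_iff.mpr (Or.inr rfl)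
  have hmem : ∀ k ∈ sixtyPairs, 2 * zmodCos k.1 + 2 * zmodCos k.2 = torusEigenvalue 60 24 10 := by
    rintro ⟨k, l⟩ hkl
    simp only [sixtyPairs, Finset.mem_union, Finset.mem_product, Finset.mem_insert,
      Finset.mem_singleton] at hkl
    have h1 := zmodCos_sixty_ten
    have h2 := zmodCos_sixty_fifteen
    have h3 := zmodCos_sixty_twentyFour
    have h4 := zmodCos_sixty_eighteen
    have h5 := zmodCos_sixty_eight_add
    rw [torusEigenvalue_sixty]
    rcases hkl with (⟨rfl | rfl, rfl | rfl⟩ | ⟨rfl | rfl, rfl | rfl⟩) | ⟨rfl | rfl, rfl | rfl⟩ <;>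
      simp only [hneg] <;> linarith
  refine Finset.card_le_card fun k hk => ?_
  simp only [Finset.mem_filter, Finset.mem_univ, true_and]
  rcases Finset.mem_union.mp hk with hk | hk
  · exact hmem k hk
  · obtain ⟨l, hl, rfl⟩ := Finset.mem_image.mp hk
    rw [Prod.fst_swap, Prod.snd_swap, add_comm]
    exact hmem l hl

theorem proposition2p4 :
    (∀ (N : ℕ) [NeZero N], 3 ≤ N →
      ∀ μ : ℝ, Module.End.HasEigenvalue (Matrix.toLin' (torusAdjMatrix N)) μ → μ ≠ 0 →
        torusMultiplicity N μ ≤ 24) ∧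
    torusEigenvalue 60 24 10 ≠ 0 ∧
    torusMultiplicity 60 (torusEigenvalue 60 24 10) = 24 :=
  ⟨fun _ _ hN _ _ hμ => torusMultiplicity_le hN hμ, torusEigenvalue_sixty_ne_zero,
    le_antisymm (torusMultiplicity_le (by norm_num) torusEigenvalue_sixty_ne_zero)
      le_torusMultiplicity_sixty⟩
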